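/- Let $n\ge 3$, and let $S_n$ be the symmetric group on $\{1,\dots,n\}$ with simple transpositions $s_i=(i,i+1)$, $1\le i\le n-1$, length function $\ell$, right descent sets $D_R(\pi)=\{s_i:\ell(\pi s_i)<\ell(\pi)\}$ and Bruhat order $\le$. Let $\widetilde R_{u,v}(q)\in\mathbb Z[q]$ be the Kazhdan–Lusztig $\widetilde R$-polynomials, determined by: $\widetilde R_{u,v}=0$ if $u\not\le v$; $\widetilde R_{u,u}=1$; and, if $u<v$ and $s\in D_R(v)$, then $\widetilde R_{u,v}=\widetilde R_{us,vs}$ if $s\in D_R(u)$, and $\widetilde R_{u,v}=\widetilde R_{us,vs}+q\widetilde R_{u,vs}$ if $s\notin D_R(u)$. Let $v_n=3\,4\cdots n\,1\,2$ (one-line notation) and let $\Omega_n$ be the word $s_2s_1s_3s_2\cdots s_{n-1}s_{n-2}$, a reduced expression of $v_n$. For a word $\omega=s_{i_1}s_{i_2}\cdots s_{i_k}$ put $d(\omega)=\#\{1\le t<k: i_t-i_{t+1}=1\}$ and $h(\omega)=n-k+d(\omega)$. Let $F_0(q)=F_1(q)=1$ and $F_m(q)=F_{m-1}(q)+qF_{m-2}(q)$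 for $m\ge2$. Let $\sigma\in S_n$ with $\sigma\le v_n$, and let $\omega$ be any reduced expression of $\sigma$ that is a subword of $\Omega_n$. Then $h(\omega)\ge 2$ and $$\widetilde R_{\sigma,v_n}(q)=q^{2n-\ell(\sigma)-4}\,F_{h(\omega)-2}(q^{-2}).$$ -/

import Mathlib

open Polynomial LaurentPolynomial

noncomputable section

namespace SymmR

/-- The simple transposition `s_i = (i, i+1)` of `{1, …, n}`, for `1 ≤ i ≤ n - 1`. The set
`{1, …, n}` is modelled by `Fin n = {0, …, n-1}`, so `s_i` exchanges `i - 1` and `i`. Indices out of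
range (which no word below is allowed to use) give the identity. Products in `Equiv.Perm` are
compositions of functions, so `π * s n i` exchanges the entries of `π` at positions `i`, `i + 1`. -/
def s (n i : ℕ) : Equiv.Perm (Fin n) :=
  if h : 1 ≤ i ∧ i < n then Equiv.swap ⟨i - 1, by omega⟩ ⟨i, h.2⟩ else 1

/-- The word `ω = s_{i_1} ⋯ s_{i_k}`, given by the list of its indices, is a word in the simple
transpositions of `S_n` whose product is `π`. -/
def IsExpr {n : ℕ} (ω : List ℕ) (π : Equiv.Perm (Fin n)) : Prop :=
  (∀ i ∈ ω, 1 ≤ i ∧ i < n) ∧ (ω.map (s n)).prod = π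

/-- The length `ℓ(π)`: the least number of simple transpositions in an expression of `π`. -/
def len {n : ℕ} (π : Equiv.Perm (Fin n)) : ℕ :=
  sInf {k | ∃ ω : List ℕ, IsExpr ω π ∧ ω.length = k}

/-- Every permutation has an expression, so the infimum in `len` is a minimum. -/
theorem exists_isExpr {n : ℕ} (π : Equiv.Perm (Fin n)) : ∃ ω : List ℕ, IsExpr ω π := by
  rcases n with _ | n
  · exact ⟨[], by simp, Subsingleton.elim _ _⟩
  have h : π ∈ Submonoid.closure
      (Set.range fun i : Fin n => Equiv.swap i.castSucc i.succ) := by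
    rw [Equiv.Perm.mclosure_swap_castSucc_succ]; trivial
  induction h using Submonoid.closure_induction with
  | mem x hx =>
    obtain ⟨i, rfl⟩ := hx
    refine ⟨[i.1 + 1], by simp, ?_⟩
    have : 1 ≤ i.1 + 1 ∧ i.1 + 1 < n + 1 := by omega
    simp only [List.map_cons, List.map_nil, List.prod_singleton, s, dif_pos this]
    congr 1
  | one => exact ⟨[], by simp, rfl⟩
  | mul x y _ _ hx hy =>
    obtain ⟨a, ha, rfl⟩ := hx
    obtain ⟨b, hb, rfl⟩ := hy
    refine ⟨a ++ b, fun i hi => ?_, by simp⟩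
    rcases List.mem_append.1 hi with h | h
    exacts [ha i h, hb i h]

/-- `ω` is a reduced expression of `π`. -/
def IsReducedExpr {n : ℕ} (ω : List ℕ) (π : Equiv.Perm (Fin n)) : Prop :=
  IsExpr ω π ∧ ω.length = len π

/-- The Bruhat order on `S_n`: `u ≤ v` when every reduced expression of `v` has a subword that is
a reduced expression of `u`. -/
def BruhatLE {n : ℕ} (u v : Equiv.Perm (Fin n)) : Prop :=
  ∀ ω : List ℕ, IsReducedExpr ω v → ∃ μ : List ℕ, μ.Sublist ω ∧ IsReducedExpr μ u

open Classical in
/-- The right descent set `D_R(π)`, as the set of the indices `i` with `1 ≤ i ≤ n - 1` and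
`ℓ(π s_i) < ℓ(π)`. -/
def descents {n : ℕ} (π : Equiv.Perm (Fin n)) : Finset ℕ :=
  (Finset.Ico 1 n).filter fun i => len (π * s n i) < len π

theorem len_mul_lt {n : ℕ} {π : Equiv.Perm (Fin n)} (h : (descents π).Nonempty) :
    len (π * s n ((descents π).max' h)) < len π := by
  classical
  exact (Finset.mem_filter.1 ((descents π).max'_mem h)).2

open Classical in
/-- The Kazhdan-Lusztig `R̃`-polynomial `R̃_{u,v}(q)`, computed by its defining recursion:
it is `0` if `u ≰ v`, it is `1` if `u = v`, and for `u < v` and a right descent `s` of `v` it is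
`R̃_{us,vs}` if `s ∈ D_R(u)` and `R̃_{us,vs} + q R̃_{u,vs}` if `s ∉ D_R(u)`.
The polynomial does not depend on which right descent of `v` is used; to have a definite recursion
we take the one with the largest index. (If `u < v` then `v ≠ 1` has a right descent, so the last
branch is never reached.) -/
def Rt {n : ℕ} (u v : Equiv.Perm (Fin n)) : ℤ[X] :=
  if ¬ BruhatLE u v then 0
  else if u = v then 1
  else if h : (descents v).Nonempty then
    if (descents v).max' h ∈ descents u then
      Rt (u * s n ((descents v).max' h)) (v * s n ((descents v).max' h))
    else
      Rt (u * s n ((descents v).max' h)) (v * s n ((descents v).max' h))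
        + X * Rt u (v * s n ((descents v).max' h))
  else 0
termination_by len v
decreasing_by all_goals exact len_mul_lt h

/-- The permutation `v_n = 3 4 ⋯ n 1 2` in one-line notation: the square of the cyclic shift
`2 3 ⋯ n 1`. -/
def v (n : ℕ) : Equiv.Perm (Fin n) := finRotate n ^ 2

theorem v_apply (n : ℕ) (i : Fin n) : (v n i : ℕ) = (i.1 + 2) % n := by
  rcases n with _ | n
  · exact i.elim0
  · simp [v, pow_two, Fin.val_add, add_assoc]

/-- The word `Ω_n = s_2 s_1 s_3 s_2 ⋯ s_{n-1} s_{n-2}`. -/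
def Omega (n : ℕ) : List ℕ := (List.range (n - 2)).flatMap fun k => [k + 2, k + 1]

/-- `d(ω)`: the number of positions `1 ≤ t < k` with `i_t - i_{t+1} = 1`, for
`ω = s_{i_1} ⋯ s_{i_k}`. -/
def d (ω : List ℕ) : ℕ := (ω.zip ω.tail).countP fun p => p.1 = p.2 + 1

/-- `h(ω) = n - ℓ(ω) + d(ω)`, as an integer; here `ℓ(ω)` is the number of letters of `ω`. -/
def h (n : ℕ) (ω : List ℕ) : ℤ := (n : ℤ) - ω.length + d ω

/-- The `q`-Fibonacci numbers (polynomials in `q`). -/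
def F : ℕ → ℤ[X]
  | 0 => 1
  | 1 => 1
  | m + 2 => F (m + 1) + X * F m

end SymmR

end

/-! Let v_{k+2} be the product of Ω_{k+2}, so that v_{k+3} = v_{k+2} s_{k+2} s_{k+1}, and let u be
the product of a reduced subword ω of Ω_{k+2}. Stripping the last two letters of v_{k+3} by the
recursion leaves only R̃_{u,v_{k+2}} and R̃_{us_{k+1},v_{k+2}}: every other term has a left index
outside S_{k+2} and vanishes.

The permutation u s_{k+1} need not be the product of a subword, so the theorem alone does not close
under induction on k. `Rt_vAt_sublist` therefore carries both polynomials. With e = h(ω) - 2, taken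
for n = k + 2, the second is q^{2k-ℓ(u)+1} times F_{e+1}(q^{-2}) or (F_{e+1} - F_e)(q^{-2}),
according to whether u has a descent at k+1. A subword of Ω_{k+3} extends ω by a subword of s_{k+2}
s_{k+1}; the four cases follow from the Fibonacci recurrence and the braid relation.

The vanishing rests on the subword property `IsReducedWord.bruhatLE_iff`, a consequence of
`exchange`. -/

namespace SymmR

variable {n : ℕ}

/-! ### Words and the exchange property -/

/-- The product in `S_n` of the simple transpositions with the given indices. -/
def wordProd (n : ℕ) (ω : List ℕ) : Equiv.Perm (Fin n) := (ω.map (s n)).prod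

@[simp] theorem wordProd_nil : wordProd n [] = 1 := rfl

@[simp] theorem wordProd_cons (i : ℕ) (ω : List ℕ) :
    wordProd n (i :: ω) = s n i * wordProd n ω := by simp [wordProd]

@[simp] theorem wordProd_append (ω μ : List ℕ) :
    wordProd n (ω ++ μ) = wordProd n ω * wordProd n μ := by simp [wordProd]

/-- All letters of the word are indices of simple transpositions of `S_n`. -/
def IsWord (n : ℕ) (ω : List ℕ) : Prop := ∀ i ∈ ω, 1 ≤ i ∧ i < n

theorem IsWord.sublist {ω μ : List ℕ} (h : IsWord n ω) (hs : μ.Sublist ω) : IsWord n μ :=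
  fun i hi => h i (hs.subset hi)

theorem IsWord.append {ω μ : List ℕ} (h : IsWord n ω) (h' : IsWord n μ) : IsWord n (ω ++ μ) :=
  fun i hi => (List.mem_append.1 hi).elim (h i) (h' i)

theorem isWord_singleton {i : ℕ} (h₁ : 1 ≤ i) (h₂ : i < n) : IsWord n [i] := by
  simpa [IsWord] using ⟨h₁, h₂⟩

theorem s_eq_swap {i : ℕ} (h₁ : 1 ≤ i) (h₂ : i < n) :
    s n i = Equiv.swap ⟨i - 1, by omega⟩ ⟨i, h₂⟩ := dif_pos ⟨h₁, h₂⟩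

@[simp] theorem s_mul_self (i : ℕ) : s n i * s n i = 1 := by
  unfold s; split_ifs <;> simp

@[simp] theorem mul_s_mul_s (π : Equiv.Perm (Fin n)) (i : ℕ) : π * s n i * s n i = π := by
  rw [mul_assoc, s_mul_self, mul_one]

theorem s_apply_val {i : ℕ} (h₁ : 1 ≤ i) (h₂ : i < n) (x : Fin n) :
    (s n i x : ℕ) = if (x : ℕ) = i - 1 then i else if (x : ℕ) = i then i - 1 else x := by
  rw [s_eq_swap h₁ h₂, Equiv.swap_apply_def]
  simp only [Fin.ext_iff]
  split_ifs <;> simp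

theorem len_le {ω : List ℕ} (h : IsWord n ω) : len (wordProd n ω) ≤ ω.length :=
  Nat.sInf_le ⟨ω, ⟨h, rfl⟩, rfl⟩

theorem exists_isReducedExpr (π : Equiv.Perm (Fin n)) : ∃ ω, IsReducedExpr ω π := by
  obtain ⟨ω, hω⟩ := exists_isExpr π
  obtain ⟨μ, h, h'⟩ := Nat.sInf_mem (s := {k | ∃ ω : List ℕ, IsExpr ω π ∧ ω.length = k})
    ⟨_, ω, hω, rfl⟩
  exact ⟨μ, h, h'⟩

theorem len_mul_s_le (π : Equiv.Perm (Fin n)) {i : ℕ} (h₁ : 1 ≤ i) (h₂ : i < n) :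
    len (π * s n i) ≤ len π + 1 := by
  obtain ⟨ω, ⟨hw, rfl⟩, hl⟩ := exists_isReducedExpr π
  have := len_le (IsWord.append hw (isWord_singleton h₁ h₂))
  simp only [wordProd_append, wordProd_cons, wordProd_nil, mul_one, List.length_append,
    List.length_singleton] at this
  rw [← hl]
  exact this

/-- The strong exchange property of the symmetric group. -/
theorem exchange {ω : List ℕ} (h : IsWord n ω) {a b : Fin n} (hab : a < b)
    (hlt : wordProd n ω b < wordProd n ω a) :
    ∃ μ : List ℕ, μ.Sublist ω ∧ μ.length + 1 = ω.length ∧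
      wordProd n μ = wordProd n ω * Equiv.swap a b := by
  induction ω with
  | nil => exact absurd hlt (by simpa using hab.le)
  | cons i ω ih =>
    by_cases hlt' : wordProd n ω b < wordProd n ω a
    · obtain ⟨μ, h₁, h₂, h₃⟩ := ih (h.sublist (List.sublist_cons_self i ω)) hlt'
      exact ⟨i :: μ, h₁.cons_cons i, by simp [h₂], by rw [wordProd_cons, wordProd_cons, h₃, mul_assoc]⟩
    -- If s_i creates the inversion, the two values must be i-1 and i, so s_i itself is the letter
    -- to delete.
    · obtain ⟨hi₁, hi₂⟩ := h i (by simp)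
      have hne : wordProd n ω a ≠ wordProd n ω b := fun e => hab.ne ((wordProd n ω).injective e)
      have hA := s_apply_val hi₁ hi₂ (wordProd n ω a)
      have hB := s_apply_val hi₁ hi₂ (wordProd n ω b)
      simp only [wordProd_cons, Equiv.Perm.mul_apply, Fin.lt_def, Fin.ext_iff, ne_eq, not_lt]
        at hlt hlt' hne
      have hA' : (wordProd n ω a : ℕ) = i - 1 ∧ (wordProd n ω b : ℕ) = i := by
        split_ifs at hA hB <;> omega
      refine ⟨ω, List.sublist_cons_self i ω, rfl, ?_⟩
      have hs : s n i = Equiv.swap (wordProd n ω a) (wordProd n ω b) := by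
        rw [s_eq_swap hi₁ hi₂]
        congr 1
        · exact Fin.ext hA'.1.symm
        · exact Fin.ext hA'.2.symm
      rw [wordProd_cons, mul_assoc, Equiv.mul_swap_eq_swap_mul, ← mul_assoc, hs,
        Equiv.swap_mul_self, one_mul]

/-! ### Descents and reduced words -/

/-- `π` has a descent at position `i`, in terms of its values. -/
def DescentAt (π : Equiv.Perm (Fin n)) (i : ℕ) : Prop :=
  ∃ h : 1 ≤ i ∧ i < n, π ⟨i, h.2⟩ < π ⟨i - 1, by omega⟩

theorem descentAt_mul_s (π : Equiv.Perm (Fin n)) {i : ℕ} (h₁ : 1 ≤ i) (h₂ : i < n) :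
    DescentAt (π * s n i) i ↔ ¬ DescentAt π i := by
  have hne : π ⟨i, h₂⟩ ≠ π ⟨i - 1, by omega⟩ := fun e => by
    have := π.injective e
    simp only [Fin.mk.injEq] at this
    omega
  simp only [DescentAt, s_eq_swap h₁ h₂, Equiv.Perm.mul_apply, Equiv.swap_apply_left,
    Equiv.swap_apply_right, h₁, h₂, and_self, exists_true_left, not_lt]
  exact ⟨le_of_lt, fun h => lt_of_le_of_ne h hne.symm⟩

theorem DescentAt.len_lt {π : Equiv.Perm (Fin n)} {i : ℕ} (h : DescentAt π i) :
    len (π * s n i) < len π := by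
  obtain ⟨⟨h₁, h₂⟩, h⟩ := h
  obtain ⟨ω, ⟨hw, rfl⟩, hl⟩ := exists_isReducedExpr π
  obtain ⟨μ, hs, hlen, hμ⟩ := exchange hw
    (show (⟨i - 1, by omega⟩ : Fin n) < ⟨i, h₂⟩ by simp only [Fin.lt_def]; omega) h
  have := len_le (IsWord.sublist hw hs)
  rw [hμ, ← s_eq_swap h₁ h₂] at this
  rw [← hl]
  change len (wordProd n ω * s n i) < _
  omega

theorem len_lt_of_not_descentAt {π : Equiv.Perm (Fin n)} {i : ℕ} (h₁ : 1 ≤ i) (h₂ : i < n)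
    (h : ¬ DescentAt π i) : len π < len (π * s n i) := by
  simpa using ((descentAt_mul_s π h₁ h₂).2 h).len_lt

theorem mem_descents {π : Equiv.Perm (Fin n)} {i : ℕ} : i ∈ descents π ↔ DescentAt π i := by
  classical
  simp only [descents, Finset.mem_filter, Finset.mem_Ico]
  refine ⟨fun ⟨⟨h₁, h₂⟩, h⟩ => ?_, fun h => ⟨h.1, h.len_lt⟩⟩
  by_contra hn
  exact absurd (len_lt_of_not_descentAt h₁ h₂ hn) h.not_gt

/-- The word is a reduced expression of its product. -/
def IsReducedWord (n : ℕ) (ω : List ℕ) : Prop := IsReducedExpr ω (wordProd n ω)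

theorem IsReducedExpr.wordProd_eq {ω : List ℕ} {π : Equiv.Perm (Fin n)} (h : IsReducedExpr ω π) :
    wordProd n ω = π := h.1.2

theorem IsReducedExpr.isReducedWord {ω : List ℕ} {π : Equiv.Perm (Fin n)}
    (h : IsReducedExpr ω π) : IsReducedWord n ω := by
  obtain rfl := h.wordProd_eq
  exact h

theorem IsReducedWord.isWord {ω : List ℕ} (h : IsReducedWord n ω) : IsWord n ω := h.1.1

theorem isReducedWord_nil : IsReducedWord n [] :=
  have hw : IsWord n [] := by simp [IsWord]
  ⟨⟨hw, rfl⟩, le_antisymm (Nat.zero_le _) (len_le hw)⟩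

theorem IsReducedWord.append_singleton {ω : List ℕ} (h : IsReducedWord n ω) {i : ℕ} (h₁ : 1 ≤ i)
    (h₂ : i < n) (hd : ¬ DescentAt (wordProd n ω) i) : IsReducedWord n (ω ++ [i]) := by
  have hw := h.isWord.append (isWord_singleton h₁ h₂)
  refine ⟨⟨hw, rfl⟩, ?_⟩
  have := len_lt_of_not_descentAt h₁ h₂ hd
  have h' := len_le hw
  have hl := h.2
  simp only [wordProd_append, wordProd_cons, wordProd_nil, mul_one, List.length_append,
    List.length_singleton] at h' ⊢
  omega

theorem IsReducedWord.of_append {ω : List ℕ} {i : ℕ} (h : IsReducedWord n (ω ++ [i])) :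
    IsReducedWord n ω ∧ ¬ DescentAt (wordProd n ω) i := by
  have hw : IsWord n ω := h.isWord.sublist (List.sublist_append_left _ _)
  obtain ⟨h₁, h₂⟩ := h.isWord i (by simp)
  have hl := h.2
  have h' := len_le hw
  have h'' := len_mul_s_le (wordProd n ω) h₁ h₂
  simp only [wordProd_append, wordProd_cons, wordProd_nil, mul_one, List.length_append,
    List.length_singleton] at hl
  refine ⟨⟨⟨hw, rfl⟩, by omega⟩, fun hd => ?_⟩
  have := hd.len_lt
  omega

theorem IsReducedWord.of_append_left {ω τ : List ℕ} (h : IsReducedWord n (ω ++ τ)) :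
    IsReducedWord n ω := by
  induction τ using List.reverseRecOn with
  | nil => simpa using h
  | append_singleton τ i ih =>
    rw [← List.append_assoc] at h
    exact ih h.of_append.1

/-- Every word contains a reduced word with the same product. -/
theorem exists_reduced_sublist {ω : List ℕ} (h : IsWord n ω) :
    ∃ μ : List ℕ, μ.Sublist ω ∧ IsReducedExpr μ (wordProd n ω) := by
  induction ω using List.reverseRecOn with
  | nil => exact ⟨[], List.Sublist.refl _, isReducedWord_nil⟩
  | append_singleton ω i ih =>
    obtain ⟨h₁, h₂⟩ := h i (by simp)
    obtain ⟨μ, hs, hμ⟩ := ih (h.sublist (List.sublist_append_left _ _))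
    have hμr := hμ.isReducedWord
    -- At a descent, a letter of μ is deleted instead of appending i.
    by_cases hd : DescentAt (wordProd n μ) i
    · have hlt := hd.len_lt
      have hle := len_mul_s_le (wordProd n μ * s n i) h₁ h₂
      obtain ⟨_, hd⟩ := hd
      obtain ⟨ν, hνs, hνl, hν⟩ := exchange hμr.isWord
        (show (⟨i - 1, by omega⟩ : Fin n) < ⟨i, h₂⟩ by simp only [Fin.lt_def]; omega) hd
      rw [← s_eq_swap h₁ h₂] at hν
      refine ⟨ν, (hνs.trans hs).trans (List.sublist_append_left _ _),
        ⟨hμr.isWord.sublist hνs, ?_⟩, ?_⟩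
      · change wordProd n ν = _
        rw [hν, hμ.wordProd_eq]; simp
      · have := hμr.2
        rw [mul_s_mul_s] at hle
        rw [hμ.wordProd_eq] at *
        simp only [wordProd_append, wordProd_cons, wordProd_nil, mul_one]
        omega
    · have := hμr.append_singleton h₁ h₂ hd
      refine ⟨μ ++ [i], hs.append (List.Sublist.refl _), ?_⟩
      rw [IsReducedWord] at this
      rwa [wordProd_append, hμ.wordProd_eq, ← wordProd_append] at this

/-! ### Bruhat graph and subword property -/

/-- One step up in the Bruhat graph. -/
def BruhatStep (x y : Equiv.Perm (Fin n)) : Prop :=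
  ∃ a b : Fin n, a < b ∧ x a < x b ∧ y = x * Equiv.swap a b

theorem bruhatStep_mul_s {x : Equiv.Perm (Fin n)} {i : ℕ} (h₁ : 1 ≤ i) (h₂ : i < n)
    (hd : ¬ DescentAt x i) : BruhatStep x (x * s n i) := by
  refine ⟨⟨i - 1, by omega⟩, ⟨i, h₂⟩, by simp only [Fin.lt_def]; omega, ?_, by rw [s_eq_swap h₁ h₂]⟩
  refine lt_of_le_of_ne (not_lt.1 fun h => hd ⟨⟨h₁, h₂⟩, h⟩) fun e => ?_
  have := x.injective e
  simp only [Fin.mk.injEq] at this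
  omega

/-- Conjugation by s_i turns the swap of a, b into that of their images, and a < b is preserved
unless s_i is that very swap. -/
theorem BruhatStep.mul_s {x y : Equiv.Perm (Fin n)} (h : BruhatStep x y) {i : ℕ} (h₁ : 1 ≤ i)
    (h₂ : i < n) : x * s n i = y ∨ BruhatStep (x * s n i) (y * s n i) := by
  obtain ⟨a, b, hab, hx, rfl⟩ := h
  by_cases hi : (a : ℕ) = i - 1 ∧ (b : ℕ) = i
  · left
    rw [s_eq_swap h₁ h₂]
    congr 2
    · exact Fin.ext hi.1.symm
    · exact Fin.ext hi.2.symm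
  · right
    have hss : ∀ c, s n i (s n i c) = c := fun c => by
      rw [← Equiv.Perm.mul_apply, s_mul_self, Equiv.Perm.one_apply]
    refine ⟨s n i a, s n i b, ?_, by simpa [hss] using hx, ?_⟩
    · have hA := s_apply_val h₁ h₂ a
      have hB := s_apply_val h₁ h₂ b
      rw [Fin.lt_def] at hab ⊢
      split_ifs at hA hB <;> omega
    · rw [mul_assoc, mul_assoc, Equiv.mul_swap_eq_swap_mul (s n i) (s n i a), hss, hss]

theorem BruhatStep.chain_mul_s {x y : Equiv.Perm (Fin n)} (h : Relation.ReflTransGen BruhatStep x y)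
    {i : ℕ} (h₁ : 1 ≤ i) (h₂ : i < n) :
    Relation.ReflTransGen BruhatStep (x * s n i) y ∨
      Relation.ReflTransGen BruhatStep (x * s n i) (y * s n i) := by
  induction h using Relation.ReflTransGen.head_induction_on with
  | refl => exact Or.inr .refl
  | head hxz hzy ih =>
    rcases hxz.mul_s h₁ h₂ with e | hs
    · exact Or.inl (e ▸ hzy)
    · exact ih.imp (.head hs) (.head hs)

theorem IsReducedWord.chain_of_sublist {ω : List ℕ} (h : IsReducedWord n ω) {μ : List ℕ}
    (hs : μ.Sublist ω) : Relation.ReflTransGen BruhatStep (wordProd n μ) (wordProd n ω) := by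
  induction ω using List.reverseRecOn generalizing μ with
  | nil => rw [List.sublist_nil.1 hs]
  | append_singleton ω i ih =>
    obtain ⟨h₁, h₂⟩ := h.isWord i (by simp)
    obtain ⟨hr, hd⟩ := h.of_append
    have hstep := bruhatStep_mul_s h₁ h₂ hd
    simp only [wordProd_append, wordProd_cons, wordProd_nil, mul_one]
    obtain ⟨μ₁, μ₂, rfl, hs₁, hs₂⟩ := List.sublist_append_iff.1 hs
    rcases List.sublist_singleton.1 hs₂ with rfl | rfl
    · simpa using (ih hr hs₁).tail hstep
    · simp only [wordProd_append, wordProd_cons, wordProd_nil, mul_one]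
      rcases BruhatStep.chain_mul_s (ih hr hs₁) h₁ h₂ with h | h
      · exact h.tail hstep
      · exact h

/-- Each step down the chain deletes one letter by `exchange`; the word need not be reduced. -/
theorem exists_sublist_of_chain {x y : Equiv.Perm (Fin n)}
    (h : Relation.ReflTransGen BruhatStep x y) {ω : List ℕ} (hw : IsWord n ω)
    (hω : wordProd n ω = y) : ∃ μ : List ℕ, μ.Sublist ω ∧ wordProd n μ = x := by
  induction h using Relation.ReflTransGen.head_induction_on with
  | refl => exact ⟨ω, List.Sublist.refl _, hω⟩
  | head hxz _ ih =>
    obtain ⟨μ, hs, hμ⟩ := ih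
    obtain ⟨a, b, hab, hx, rfl⟩ := hxz
    obtain ⟨ν, hνs, -, hν⟩ := exchange (hw.sublist hs) hab (by simpa [hμ] using hx)
    exact ⟨ν, hνs.trans hs, by simp [hν, hμ, mul_assoc]⟩

/-- The subword property: the Bruhat order can be tested on one reduced expression. -/
theorem IsReducedWord.bruhatLE_iff {ω : List ℕ} (h : IsReducedWord n ω)
    {u : Equiv.Perm (Fin n)} :
    BruhatLE u (wordProd n ω) ↔ ∃ μ : List ℕ, μ.Sublist ω ∧ wordProd n μ = u := by
  constructor
  · intro hu
    obtain ⟨μ, hs, hμ⟩ := hu ω h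
    exact ⟨μ, hs, hμ.wordProd_eq⟩
  · rintro ⟨μ, hs, rfl⟩ ω' hω'
    obtain ⟨ν, hνs, hν⟩ := exists_sublist_of_chain (h.chain_of_sublist hs)
      hω'.isReducedWord.isWord hω'.wordProd_eq
    obtain ⟨ρ, hρs, hρ⟩ := exists_reduced_sublist (hω'.isReducedWord.isWord.sublist hνs)
    exact ⟨ρ, hρs.trans hνs, hν ▸ hρ⟩

/-! ### The recursion at the largest descent -/

theorem Rt_eq_zero {u w : Equiv.Perm (Fin n)} (h : ¬ BruhatLE u w) : Rt u w = 0 := by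
  rw [Rt, if_pos h]

theorem Rt_self {w : Equiv.Perm (Fin n)} : Rt w w = 1 := by
  rw [Rt, if_neg, if_pos rfl]
  exact not_not.2 fun ω hω => ⟨ω, List.Sublist.refl _, hω⟩

/-- Its contrapositive makes both sides of the recursion vanish when u ≰ w, so the recursion can be
used without checking u < w. -/
theorem bruhatLE_of_bruhatLE_mul_s {u w : Equiv.Perm (Fin n)} {i : ℕ} (hd : DescentAt w i)
    (hu : BruhatLE u (w * s n i) ∨ BruhatLE (u * s n i) (w * s n i)) : BruhatLE u w := by
  obtain ⟨h₁, h₂⟩ := hd.1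
  obtain ⟨ω, hω⟩ := exists_isReducedExpr (w * s n i)
  have hr := hω.isReducedWord
  have hd' : ¬ DescentAt (wordProd n ω) i := by
    rw [hω.wordProd_eq, descentAt_mul_s w h₁ h₂]; exact not_not.2 hd
  have hr' := hr.append_singleton h₁ h₂ hd'
  have hw : w = wordProd n (ω ++ [i]) := by simp [hω.wordProd_eq]
  rw [hw, hr'.bruhatLE_iff]
  rw [← hω.wordProd_eq, hr.bruhatLE_iff, hr.bruhatLE_iff] at hu
  rcases hu with ⟨μ, hs, hμ⟩ | ⟨μ, hs, hμ⟩
  · exact ⟨μ, hs.trans (List.sublist_append_left _ _), hμ⟩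
  · exact ⟨μ ++ [i], hs.append (List.Sublist.refl _), by simp [hμ]⟩

/-- `i` is the largest descent of `w`. -/
def IsMaxDescent (w : Equiv.Perm (Fin n)) (i : ℕ) : Prop :=
  DescentAt w i ∧ ∀ j, DescentAt w j → j ≤ i

theorem IsMaxDescent.max'_eq {w : Equiv.Perm (Fin n)} {i : ℕ} (hi : IsMaxDescent w i)
    (hn : (descents w).Nonempty) : (descents w).max' hn = i :=
  le_antisymm (hi.2 _ (mem_descents.1 ((descents w).max'_mem hn)))
    ((descents w).le_max' _ (mem_descents.2 hi.1))

theorem Rt_of_descentAt {u w : Equiv.Perm (Fin n)} {i : ℕ} (hi : IsMaxDescent w i)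
    (hu : DescentAt u i) : Rt u w = Rt (u * s n i) (w * s n i) := by
  have hne : (descents w).Nonempty := ⟨i, mem_descents.2 hi.1⟩
  by_cases hle : BruhatLE u w
  · by_cases he : u = w
    · rw [he, Rt_self, Rt_self]
    · rw [Rt, if_neg (not_not.2 hle), if_neg he, dif_pos hne]
      rw [hi.max'_eq, if_pos (mem_descents.2 hu)]
  · rw [Rt_eq_zero hle, Rt_eq_zero fun h => hle (bruhatLE_of_bruhatLE_mul_s hi.1 (.inr h))]

theorem Rt_of_not_descentAt {u w : Equiv.Perm (Fin n)} {i : ℕ} (hi : IsMaxDescent w i)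
    (hu : ¬ DescentAt u i) :
    Rt u w = Rt (u * s n i) (w * s n i) + X * Rt u (w * s n i) := by
  have hne : (descents w).Nonempty := ⟨i, mem_descents.2 hi.1⟩
  by_cases hle : BruhatLE u w
  · have he : u ≠ w := fun e => hu (e ▸ hi.1)
    rw [Rt, if_neg (not_not.2 hle), if_neg he, dif_pos hne]
    rw [hi.max'_eq, if_neg (mt mem_descents.1 hu)]
  · rw [Rt_eq_zero hle, Rt_eq_zero fun h => hle (bruhatLE_of_bruhatLE_mul_s hi.1 (.inr h)),
      Rt_eq_zero fun h => hle (bruhatLE_of_bruhatLE_mul_s hi.1 (.inl h)), mul_zero, add_zero]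

/-! ### The permutations v_{k+2} inside S_n -/

theorem Omega_succ (k : ℕ) : Omega (k + 3) = Omega (k + 2) ++ [k + 2, k + 1] := by
  simp [Omega, List.range_succ, List.flatMap_append]

theorem mem_Omega {k i : ℕ} (hi : i ∈ Omega (k + 2)) : 1 ≤ i ∧ i < k + 2 := by
  simp only [Omega, List.mem_flatMap, List.mem_range] at hi
  obtain ⟨j, hj, hi⟩ := hi
  simp only [List.mem_cons, List.not_mem_nil, or_false] at hi
  omega

/-- The permutation `v_{k+2}`, as an element of `S_n`. -/
def vAt (n k : ℕ) : Equiv.Perm (Fin n) := wordProd n (Omega (k + 2))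

theorem vAt_zero : vAt n 0 = 1 := by simp [vAt, Omega]

theorem vAt_succ (k : ℕ) : vAt n (k + 1) = vAt n k * s n (k + 2) * s n (k + 1) := by
  rw [vAt, vAt, Omega_succ]
  simp [mul_assoc]

theorem vAt_apply {k : ℕ} (hk : k + 2 ≤ n) (x : Fin n) :
    (vAt n k x : ℕ) = if (x : ℕ) < k then (x : ℕ) + 2 else
      if (x : ℕ) < k + 2 then (x : ℕ) - k else x := by
  induction k generalizing x with
  | zero => rw [vAt_zero]; simp
  | succ k ih =>
    rw [vAt_succ, Equiv.Perm.mul_apply, Equiv.Perm.mul_apply, ih (by omega),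
      s_apply_val (by omega) (by omega), s_apply_val (by omega) (by omega)]
    split_ifs <;> omega

theorem v_eq_vAt {k : ℕ} : v (k + 2) = vAt (k + 2) k := by
  ext x
  rw [v_apply, vAt_apply le_rfl]
  have := x.2
  split_ifs with h₁
  · exact Nat.mod_eq_of_lt (by omega)
  · rw [Nat.mod_eq_sub_mod (by omega), Nat.mod_eq_of_lt (by omega)]; omega

theorem descentAt_iff_val {π : Equiv.Perm (Fin n)} {i : ℕ} (h₁ : 1 ≤ i) (h₂ : i < n) :
    DescentAt π i ↔ (π ⟨i, h₂⟩ : ℕ) < π ⟨i - 1, by omega⟩ :=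
  ⟨fun h => h.2, fun h => ⟨⟨h₁, h₂⟩, h⟩⟩

/-- Together with `isMaxDescent_vAt_succ`, this shows that the largest descent always strips the
last letter of Ω, so independence of the chosen descent is never needed. -/
theorem isMaxDescent_vAt_mul_s {k : ℕ} (hk : k + 2 < n) :
    IsMaxDescent (vAt n k * s n (k + 2)) (k + 2) := by
  have key : ∀ x : Fin n, ((vAt n k * s n (k + 2)) x : ℕ) = if (x : ℕ) < k then (x : ℕ) + 2 else
      if (x : ℕ) = k then 0 else if (x : ℕ) = k + 1 then k + 2 else
      if (x : ℕ) = k + 2 then 1 else x := fun x => by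
    rw [Equiv.Perm.mul_apply, vAt_apply (by omega), s_apply_val (by omega) (by omega)]
    split_ifs <;> omega
  refine ⟨(descentAt_iff_val (by omega) hk).2 ?_, fun j hj => ?_⟩
  · rw [key, key]; dsimp only; split_ifs <;> omega
  · obtain ⟨h₁, h₂⟩ := hj.1
    rw [descentAt_iff_val h₁ h₂, key, key] at hj
    dsimp only at hj
    split_ifs at hj <;> omega

theorem isMaxDescent_vAt_succ {k : ℕ} (hk : k + 2 < n) :
    IsMaxDescent (vAt n (k + 1)) (k + 1) := by
  have key := fun x => vAt_apply (n := n) (k := k + 1) (by omega) x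
  refine ⟨(descentAt_iff_val (by omega) (by omega)).2 ?_, fun j hj => ?_⟩
  · rw [key, key]; dsimp only; split_ifs <;> omega
  · obtain ⟨h₁, h₂⟩ := hj.1
    rw [descentAt_iff_val h₁ h₂, key, key] at hj
    dsimp only at hj
    split_ifs at hj <;> omega

theorem isReducedWord_Omega {k : ℕ} (hk : k + 2 ≤ n) : IsReducedWord n (Omega (k + 2)) := by
  induction k with
  | zero => exact isReducedWord_nil
  | succ k ih =>
    have h₁ := isMaxDescent_vAt_mul_s (n := n) (k := k) (by omega)
    have h₂ := isMaxDescent_vAt_succ (n := n) (k := k) (by omega)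
    rw [Omega_succ, show [k + 2, k + 1] = [k + 2] ++ [k + 1] from rfl, ← List.append_assoc]
    refine ((ih (by omega)).append_singleton (by omega) (by omega) ?_).append_singleton
      (by omega) (by omega) ?_
    · exact (descentAt_mul_s _ (by omega) (by omega)).1 h₁.1
    · rw [vAt_succ] at h₂
      simpa [vAt] using (descentAt_mul_s _ (by omega) (by omega)).1 h₂.1

/-! ### Vanishing outside S_{k+2} -/

/-- `u` fixes all points from `m` on, that is, `u ∈ S_m`. -/
def FixesFrom (m : ℕ) (u : Equiv.Perm (Fin n)) : Prop := ∀ x : Fin n, m ≤ x → u x = x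

theorem FixesFrom.val_lt {m : ℕ} {u : Equiv.Perm (Fin n)} (h : FixesFrom m u) {x : Fin n}
    (hx : (x : ℕ) < m) : (u x : ℕ) < m := by
  by_contra hn
  have := u.injective (h (u x) (by omega))
  rw [this] at hn
  exact hn hx

theorem fixesFrom_s {m i : ℕ} (h₁ : 1 ≤ i) (h₂ : i < n) (hm : i < m) : FixesFrom m (s n i) :=
  fun x hx => Fin.ext (by rw [s_apply_val h₁ h₂]; split_ifs <;> omega)

theorem FixesFrom.mul {m : ℕ} {u w : Equiv.Perm (Fin n)} (hu : FixesFrom m u)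
    (hw : FixesFrom m w) : FixesFrom m (u * w) := fun x hx => by
  rw [Equiv.Perm.mul_apply, hw x hx, hu x hx]

theorem FixesFrom.mul_s {m i : ℕ} {u : Equiv.Perm (Fin n)} (hu : FixesFrom m u) (h₁ : 1 ≤ i)
    (h₂ : i < n) (hm : i < m) : FixesFrom m (u * s n i) := hu.mul (fixesFrom_s h₁ h₂ hm)

theorem fixesFrom_wordProd {m : ℕ} {ω : List ℕ} (hw : IsWord n ω) (hm : ∀ i ∈ ω, i < m) :
    FixesFrom m (wordProd n ω) := by
  induction ω with
  | nil => exact fun _ _ => rfl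
  | cons i ω ih =>
    rw [wordProd_cons]
    obtain ⟨h₁, h₂⟩ := hw i (by simp)
    exact (fixesFrom_s h₁ h₂ (hm i (by simp))).mul
      (ih (hw.sublist (List.sublist_cons_self _ _)) fun j hj => hm j (by simp [hj]))

theorem fixesFrom_of_sublist_Omega {k : ℕ} (hk : k + 2 ≤ n) {ω : List ℕ}
    (hs : ω.Sublist (Omega (k + 2))) : FixesFrom (k + 2) (wordProd n ω) :=
  fixesFrom_wordProd ((isReducedWord_Omega hk).isWord.sublist hs)
    fun _ hi => (mem_Omega (hs.subset hi)).2

theorem Rt_vAt_eq_zero {k : ℕ} (hk : k + 2 ≤ n) {u : Equiv.Perm (Fin n)}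
    (hu : ¬ FixesFrom (k + 2) u) : Rt u (vAt n k) = 0 := by
  refine Rt_eq_zero fun h => hu ?_
  rw [vAt, (isReducedWord_Omega hk).bruhatLE_iff] at h
  obtain ⟨μ, hs, rfl⟩ := h
  exact fixesFrom_of_sublist_Omega hk hs

theorem FixesFrom.not_descentAt {m : ℕ} {u : Equiv.Perm (Fin n)} (h : FixesFrom m u) (h₁ : 1 ≤ m)
    (h₂ : m < n) : ¬ DescentAt u m := by
  rw [descentAt_iff_val h₁ h₂, h ⟨m, h₂⟩ le_rfl]
  have := h.val_lt (x := ⟨m - 1, by omega⟩) (show m - 1 < m by omega)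
  dsimp only at this ⊢
  omega

theorem not_fixesFrom_of_apply {m : ℕ} {u : Equiv.Perm (Fin n)} (hm : m < n)
    (h : (u ⟨m, hm⟩ : ℕ) < m) : ¬ FixesFrom m u := fun hu => by
  rw [hu ⟨m, hm⟩ le_rfl] at h
  exact lt_irrefl _ h

theorem s_apply_left {i : ℕ} (h₁ : 1 ≤ i) (h₂ : i < n) (h' : i - 1 < n) :
    s n i ⟨i - 1, h'⟩ = ⟨i, h₂⟩ := by
  rw [s_eq_swap h₁ h₂, Equiv.swap_apply_left]

theorem s_apply_pred {i : ℕ} (h₂ : i + 1 < n) (h' : i < n) :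
    s n (i + 1) ⟨i, h'⟩ = ⟨i + 1, h₂⟩ := s_apply_left (by omega) h₂ _

theorem s_succ_apply {i : ℕ} (h₂ : i + 1 < n) :
    s n (i + 1) ⟨i + 1, h₂⟩ = ⟨i, by omega⟩ := by
  rw [s_eq_swap (by omega) h₂, Equiv.swap_apply_right]; rfl

theorem s_apply_of_ne {i j : ℕ} (hj : j < n) (h₁ : j ≠ i + 1) (h₂ : j ≠ i) :
    s n (i + 1) ⟨j, hj⟩ = ⟨j, hj⟩ := by
  unfold s
  split_ifs with h
  · refine Equiv.swap_apply_of_ne_of_ne ?_ ?_ <;> simpa [Fin.ext_iff]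
  · rfl

theorem s_braid {i : ℕ} (h₁ : 1 ≤ i) (h₂ : i + 1 < n) :
    s n (i + 1) * s n i * s n (i + 1) = s n i * s n (i + 1) * s n i := by
  have key : ∀ a b c : Fin n, a ≠ b → b ≠ c → a ≠ c →
      Equiv.swap b c * Equiv.swap a b * Equiv.swap b c =
        Equiv.swap a b * Equiv.swap b c * Equiv.swap a b := fun a b c hab hbc hac => by
    rw [Equiv.swap_mul_swap_mul_swap hab hac, Equiv.swap_comm a b, Equiv.swap_comm b c,
      Equiv.swap_mul_swap_mul_swap hbc.symm hac.symm, Equiv.swap_comm]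
  rw [s_eq_swap h₁ (show i < n by omega), s_eq_swap (show 1 ≤ i + 1 by omega) h₂]
  refine key _ _ _ ?_ ?_ ?_ <;> (simp only [ne_eq, Fin.mk.injEq]; omega)

/-! ### Reduction from v_{k+3} to v_{k+2} -/

theorem Rt_vAt_mul_s_of_fixesFrom {k : ℕ} (hk : k + 2 < n) {u : Equiv.Perm (Fin n)}
    (hu : FixesFrom (k + 2) u) : Rt u (vAt n k * s n (k + 2)) = X * Rt u (vAt n k) := by
  rw [Rt_of_not_descentAt (isMaxDescent_vAt_mul_s hk) (hu.not_descentAt (by omega) hk),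
    mul_s_mul_s, Rt_vAt_eq_zero (by omega), zero_add]
  refine not_fixesFrom_of_apply hk ?_
  rw [Equiv.Perm.mul_apply, s_succ_apply hk]
  exact hu.val_lt (Nat.lt_succ_self _)

theorem Rt_mul_s_vAt_mul_s {k : ℕ} (hk : k + 2 < n) {u : Equiv.Perm (Fin n)}
    (hu : FixesFrom (k + 2) u) :
    Rt (u * s n (k + 2)) (vAt n k * s n (k + 2)) = Rt u (vAt n k) := by
  rw [Rt_of_descentAt (isMaxDescent_vAt_mul_s hk), mul_s_mul_s, mul_s_mul_s]
  exact (descentAt_mul_s _ (by omega) hk).2 (hu.not_descentAt (by omega) hk)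

theorem Rt_vAt_mul_s_eq_zero {k : ℕ} (hk : k + 2 < n) {u : Equiv.Perm (Fin n)}
    (h₁ : ¬ FixesFrom (k + 2) u) (h₂ : ¬ FixesFrom (k + 2) (u * s n (k + 2))) :
    Rt u (vAt n k * s n (k + 2)) = 0 := by
  by_cases hd : DescentAt u (k + 2)
  · rw [Rt_of_descentAt (isMaxDescent_vAt_mul_s hk) hd, mul_s_mul_s, Rt_vAt_eq_zero (by omega) h₂]
  · rw [Rt_of_not_descentAt (isMaxDescent_vAt_mul_s hk) hd, mul_s_mul_s,
      Rt_vAt_eq_zero (by omega) h₂, Rt_vAt_eq_zero (by omega) h₁, mul_zero, add_zero]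

theorem not_descentAt_mul_s_succ {k : ℕ} (hk : k + 2 < n) {u : Equiv.Perm (Fin n)}
    (hu : FixesFrom (k + 2) u) : ¬ DescentAt (u * s n (k + 2)) (k + 1) := by
  rw [descentAt_iff_val (by omega) (by omega), Equiv.Perm.mul_apply, Equiv.Perm.mul_apply,
    s_apply_pred hk, hu ⟨k + 2, hk⟩ le_rfl,
    s_apply_of_ne _ (by omega) (by omega)]
  have := hu.val_lt (x := ⟨k + 1 - 1, by omega⟩) (show k + 1 - 1 < k + 2 by omega)
  dsimp only at this ⊢
  omega

theorem Rt_mul_s_mul_s_vAt_succ {k : ℕ} (hk : k + 2 < n) {u : Equiv.Perm (Fin n)}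
    (hu : FixesFrom (k + 2) u) :
    Rt (u * s n (k + 2) * s n (k + 1)) (vAt n (k + 1)) = Rt u (vAt n k) := by
  rw [Rt_of_descentAt (isMaxDescent_vAt_succ hk), vAt_succ, mul_s_mul_s, mul_s_mul_s,
    Rt_mul_s_vAt_mul_s hk hu]
  exact (descentAt_mul_s _ (by omega) (by omega)).2 (not_descentAt_mul_s_succ hk hu)

/-- The term with left index u s_{k+2} s_{k+1} drops out: neither it nor its product with s_{k+2}
lies in S_{k+2}. -/
theorem Rt_mul_s_vAt_succ {k : ℕ} (hk : k + 2 < n) {u : Equiv.Perm (Fin n)}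
    (hu : FixesFrom (k + 2) u) :
    Rt (u * s n (k + 2)) (vAt n (k + 1)) = X * Rt u (vAt n k) := by
  rw [Rt_of_not_descentAt (isMaxDescent_vAt_succ hk) (not_descentAt_mul_s_succ hk hu), vAt_succ,
    mul_s_mul_s, Rt_mul_s_vAt_mul_s hk hu, Rt_vAt_mul_s_eq_zero hk, zero_add]
  · refine not_fixesFrom_of_apply hk ?_
    rw [Equiv.Perm.mul_apply, Equiv.Perm.mul_apply, s_apply_of_ne hk (by omega) (by omega),
      s_succ_apply hk]
    exact hu.val_lt (Nat.lt_succ_self _)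
  · refine not_fixesFrom_of_apply hk ?_
    rw [Equiv.Perm.mul_apply, Equiv.Perm.mul_apply, Equiv.Perm.mul_apply, s_succ_apply hk,
      s_succ_apply (show k + 1 < n by omega), s_apply_of_ne _ (by omega) (by omega)]
    exact hu.val_lt (by dsimp only; omega)

theorem Rt_vAt_succ_of_descentAt {k : ℕ} (hk : k + 2 < n) {u : Equiv.Perm (Fin n)}
    (hu : FixesFrom (k + 2) u) (hd : DescentAt u (k + 1)) :
    Rt u (vAt n (k + 1)) = X * Rt (u * s n (k + 1)) (vAt n k) := by
  rw [Rt_of_descentAt (isMaxDescent_vAt_succ hk) hd, vAt_succ, mul_s_mul_s,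
    Rt_vAt_mul_s_of_fixesFrom hk (hu.mul_s (by omega) (by omega) (by omega))]

theorem Rt_vAt_succ_of_not_descentAt {k : ℕ} (hk : k + 2 < n) {u : Equiv.Perm (Fin n)}
    (hu : FixesFrom (k + 2) u) (hd : ¬ DescentAt u (k + 1)) :
    Rt u (vAt n (k + 1)) = X * Rt (u * s n (k + 1)) (vAt n k) + X * (X * Rt u (vAt n k)) := by
  rw [Rt_of_not_descentAt (isMaxDescent_vAt_succ hk) hd, vAt_succ, mul_s_mul_s,
    Rt_vAt_mul_s_of_fixesFrom hk (hu.mul_s (by omega) (by omega) (by omega)),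
    Rt_vAt_mul_s_of_fixesFrom hk hu]

/-- Right multiplication by s_{i+1} s_i moves the entries at positions i, i+1 to positions i+1, i+2.
-/
theorem descentAt_mul_s_mul_s {i : ℕ} (h₁ : 1 ≤ i) (h₂ : i + 1 < n) (u : Equiv.Perm (Fin n)) :
    DescentAt (u * s n (i + 1) * s n i) (i + 1) ↔ DescentAt u i := by
  obtain ⟨i, rfl⟩ := Nat.exists_eq_add_of_le' h₁
  rw [descentAt_iff_val (by omega) h₂, descentAt_iff_val (by omega) (by omega)]
  simp only [Equiv.Perm.mul_apply, Nat.add_sub_cancel]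
  rw [s_apply_of_ne h₂ (by omega) (by omega), s_succ_apply h₂,
    s_succ_apply (show i + 1 < n by omega), s_apply_of_ne (j := i) _ (by omega) (by omega)]

/-! ### The statistic d and the Fibonacci induction -/

/-- The only new adjacent pair ends in x, and the bound keeps its first letter from being x + 1. -/
theorem d_append_singleton {ω : List ℕ} {x : ℕ} (h : ∀ y ∈ ω, y ≤ x) : d (ω ++ [x]) = d ω := by
  induction ω with
  | nil => rfl
  | cons a ω ih =>
    have ih := ih fun y hy => h y (by simp [hy])
    cases ω with
    | nil =>
      have := h a (by simp)
      simp [d]; omega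
    | cons b ω =>
      simp only [d, List.cons_append, List.tail_cons, List.zip_cons_cons, List.countP_cons] at ih ⊢
      rw [ih]

theorem d_append_pair (ω : List ℕ) (x : ℕ) : d (ω ++ [x + 1, x]) = d (ω ++ [x + 1]) + 1 := by
  induction ω with
  | nil => simp [d]
  | cons a ω ih =>
    cases ω with
    | nil =>
      simp [d, List.countP_cons]; omega
    | cons b ω =>
      simp only [d, List.cons_append, List.tail_cons, List.zip_cons_cons, List.countP_cons] at ih ⊢
      rw [ih]
      omega

/-- The Laurent polynomial `q^a F_e(q^{-2})`. -/
noncomputable def fibLaurent (a : ℤ) (e : ℕ) : ℤ[T;T⁻¹] :=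
  T a * Polynomial.aeval (T (-2) : ℤ[T;T⁻¹]) (F e)

theorem T_mul_fibLaurent (a b : ℤ) (e : ℕ) : T b * fibLaurent a e = fibLaurent (b + a) e := by
  rw [fibLaurent, fibLaurent, T_add, mul_assoc]

theorem fibLaurent_one (a : ℤ) : fibLaurent a 1 = fibLaurent a 0 := rfl

theorem fibLaurent_add_two (a : ℤ) (e : ℕ) :
    fibLaurent a (e + 2) = fibLaurent a (e + 1) + fibLaurent (a - 2) e := by
  simp only [fibLaurent, F, map_add, map_mul, aeval_X, mul_add]
  rw [← mul_assoc (T a) (T (-2)), ← T_add, sub_eq_add_neg]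

theorem Rt_vAt_sublist {k : ℕ} (hk : k + 2 ≤ n) {ω : List ℕ} (hs : ω.Sublist (Omega (k + 2)))
    (hr : IsReducedWord n ω) :
    ∃ e : ℕ, e + ω.length = k + d ω ∧
      toLaurent (Rt (wordProd n ω) (vAt n k)) = fibLaurent (2 * k - ω.length) e ∧
      (DescentAt (wordProd n ω) (k + 1) →
        toLaurent (Rt (wordProd n ω * s n (k + 1)) (vAt n k)) =
          fibLaurent (2 * k - ω.length + 1) (e + 1)) ∧
      (¬ DescentAt (wordProd n ω) (k + 1) →
        toLaurent (Rt (wordProd n ω * s n (k + 1)) (vAt n k)) =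
          fibLaurent (2 * k - ω.length + 1) (e + 1) - fibLaurent (2 * k - ω.length + 1) e) := by
  induction k generalizing ω with
  | zero =>
    obtain rfl : ω = [] := List.sublist_nil.1 hs
    refine ⟨0, rfl, ?_, fun h => ?_, fun _ => ?_⟩
    · rw [vAt_zero, wordProd_nil, Rt_self]
      simp [fibLaurent, F]
    · have := h.2
      simp only [wordProd_nil, Equiv.Perm.one_apply, Fin.lt_def] at this
      omega
    -- Here F_1 - F_0 = 0, matching s_1 ≰ 1.
    · rw [zero_add, fibLaurent_one, sub_self, Rt_eq_zero, map_zero]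
      rw [vAt, (isReducedWord_Omega hk).bruhatLE_iff]
      rintro ⟨μ, hμ, h⟩
      obtain rfl : μ = [] := List.sublist_nil.1 hμ
      have h' := congrArg (fun π => (π ⟨0, by omega⟩ : Fin n).val) h
      simp only [wordProd_nil, one_mul] at h'
      rw [s_apply_val (by omega) (by omega)] at h'
      simp at h'
  | succ k ih =>
    have hk' : k + 2 < n := by omega
    rw [Omega_succ] at hs
    obtain ⟨ω, τ, rfl, hs, hτ⟩ := List.sublist_append_iff.1 hs
    have hfix := fixesFrom_of_sublist_Omega hk'.le hs
    have hlt : ∀ y ∈ ω, y ≤ k + 1 := fun y hy => Nat.le_of_lt_succ (mem_Omega (hs.subset hy)).2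
    have hlt' : ∀ y ∈ ω, y ≤ k + 2 := fun y hy => (hlt y hy).trans (Nat.le_succ _)
    have hnd : ¬ DescentAt (wordProd n ω) (k + 2) := hfix.not_descentAt (by omega) hk'
    have hrω := hr.of_append_left
    obtain ⟨e, he, h₁, h₂, h₃⟩ := ih hk'.le hs hrω
    have hempty : toLaurent (Rt (wordProd n ω) (vAt n (k + 1))) =
        fibLaurent (2 * k - ω.length + 2) (e + 1) := by
      by_cases hd : DescentAt (wordProd n ω) (k + 1)
      · rw [Rt_vAt_succ_of_descentAt hk' hfix hd, map_mul, toLaurent_X, h₂ hd, T_mul_fibLaurent]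
        congr 1; ring
      -- The summand q²R̃_{u,v_{k+2}} cancels the -F_e term, so both cases agree.
      · rw [Rt_vAt_succ_of_not_descentAt hk' hfix hd, map_add, map_mul, map_mul, map_mul,
          toLaurent_X, h₃ hd, h₁, mul_sub, T_mul_fibLaurent, T_mul_fibLaurent, T_mul_fibLaurent,
          T_mul_fibLaurent, show (1 : ℤ) + (1 + (2 * k - ω.length)) = 1 + (2 * k - ω.length + 1)
          by ring, sub_add_cancel]
        congr 1; ring
    have hcases : τ = [] ∨ τ = [k + 1] ∨ τ = [k + 2] ∨ τ = [k + 2, k + 1] := by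
      rcases List.sublist_cons_iff.1 hτ with h | ⟨ρ, rfl, h⟩
      · rcases List.sublist_singleton.1 h with h | h <;> simp [h]
      · rcases List.sublist_singleton.1 h with h | h <;> simp [h]
    rcases hcases with rfl | rfl | rfl | rfl
    · rw [List.append_nil]
      refine ⟨e + 1, by omega, ?_, fun h => absurd h hnd, fun _ => ?_⟩
      · rw [hempty]; congr 1; push_cast; ring
      -- The difference F_{e+2} - F_{e+1} leaves q^{-2} F_e.
      · rw [Rt_mul_s_vAt_succ hk' hfix, map_mul, toLaurent_X, h₁, T_mul_fibLaurent,
          fibLaurent_add_two, add_sub_cancel_left]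
        congr 1; push_cast; ring
    -- Reducedness excludes a descent of the prefix at k+1, so `h₃` applies.
    · have hd := hr.of_append.2
      have hfix' := hfix.mul_s (i := k + 1) (by omega) (by omega) (by omega)
      simp only [d_append_singleton hlt, wordProd_append, wordProd_cons, wordProd_nil, mul_one,
        List.length_append, List.length_singleton]
      refine ⟨e, by omega, ?_, fun h => absurd h (hfix'.not_descentAt (by omega) hk'), fun _ => ?_⟩
      · rw [Rt_vAt_succ_of_descentAt hk' hfix'
          ((descentAt_mul_s _ (by omega) (by omega)).2 hd), mul_s_mul_s, map_mul, toLaurent_X, h₁,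
          T_mul_fibLaurent]
        congr 1; push_cast; ring
      · rw [Rt_mul_s_vAt_succ hk' hfix', map_mul, toLaurent_X, h₃ hd, mul_sub, T_mul_fibLaurent,
          T_mul_fibLaurent]
        congr 2 <;> (push_cast; ring)
    · simp only [d_append_singleton hlt', wordProd_append, wordProd_cons, wordProd_nil, mul_one,
        List.length_append, List.length_singleton]
      refine ⟨e, by omega, ?_, fun _ => ?_,
        fun h => absurd ((descentAt_mul_s _ (by omega) hk').2 hnd) h⟩
      · rw [Rt_mul_s_vAt_succ hk' hfix, map_mul, toLaurent_X, h₁, T_mul_fibLaurent]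
        congr 1; push_cast; ring
      · rw [mul_s_mul_s, hempty]
        congr 1; push_cast; ring
    · have hlen : (2 * ((k + 1 : ℕ) : ℤ) - ((ω.length + 2 : ℕ) : ℤ)) = 2 * k - ω.length := by
        push_cast; ring
      -- The braid relation rewrites the second left index as (u s_{k+1}) s_{k+2} s_{k+1}, so both
      -- polynomials and the descent condition are inherited with the same e.
      have hbraid : wordProd n ω * s n (k + 2) * s n (k + 1) * s n (k + 2) =
          wordProd n ω * s n (k + 1) * s n (k + 2) * s n (k + 1) := by
        simp only [mul_assoc]
        rw [← mul_assoc (s n (k + 2)), s_braid (by omega) hk', mul_assoc]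
      have hfix' := hfix.mul_s (i := k + 1) (by omega) (by omega) (by omega)
      simp only [d_append_pair, d_append_singleton hlt', wordProd_append, wordProd_cons,
        wordProd_nil, mul_one, List.length_append, List.length_cons, List.length_nil, zero_add,
        Nat.reduceAdd, ← mul_assoc, hlen]
      rw [descentAt_mul_s_mul_s (by omega) hk', hbraid, Rt_mul_s_mul_s_vAt_succ hk' hfix',
        Rt_mul_s_mul_s_vAt_succ hk' hfix]
      exact ⟨e, by omega, h₁, h₂, h₃⟩

end SymmR

/-- The identity is one of Laurent polynomials in `q` with integer coefficients; `T k` is `q ^ k`.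
The first conjunct says that the index `h(ω) - 2` is a natural number. -/
theorem corollary2p3 (n : ℕ) (hn : 3 ≤ n) (σ : Equiv.Perm (Fin n))
    (hσ : SymmR.BruhatLE σ (SymmR.v n)) (ω : List ℕ)
    (hω : SymmR.IsReducedExpr ω σ) (hsub : ω.Sublist (SymmR.Omega n)) :
    2 ≤ SymmR.h n ω ∧
      Polynomial.toLaurent (SymmR.Rt σ (SymmR.v n)) =
        T (2 * (n : ℤ) - (SymmR.len σ : ℤ) - 4) *
          Polynomial.aeval (T (-2) : ℤ[T;T⁻¹]) (SymmR.F (SymmR.h n ω - 2).toNat) := by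
  obtain ⟨k, rfl⟩ := Nat.exists_eq_add_of_le' (show 2 ≤ n by omega)
  obtain ⟨e, he, h₁, -⟩ := SymmR.Rt_vAt_sublist le_rfl hsub hω.isReducedWord
  rw [hω.wordProd_eq, ← SymmR.v_eq_vAt] at h₁
  have hh : SymmR.h (k + 2) ω = e + 2 := by
    rw [SymmR.h]; push_cast; omega
  refine ⟨by omega, ?_⟩
  rw [h₁, hh, ← hω.2, SymmR.fibLaurent]
  congr 2
  · push_cast; ring
  · simp
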